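/- Let $d\ge 1$ be an integer, let $\|\cdot\|$ be any norm on $\mathbb R^d$, let $r>0$, and let $B^d(0,r)=\{x\in\mathbb R^d:\|x\|<r\}$. Let $$\mathcal G=\Big\{\tfrac1m\sum_{i=1}^m\delta_{x_i}\ :\ m\ge 1,\ x_1,\dots,x_m\in B^d(0,r)\Big\}$$ be the set of empirical measures of finite sequences of points of $B^d(0,r)$. For $q\ge 1$ real let $$W_q(\mu,\nu)=\Big(\inf_{\pi}\int\|x-y\|^q\,\mathrm d\pi(x,y)\Big)^{1/q},$$ where $\pi$ ranges over all couplings of $\mu$ and $\nu$, and for $\delta>0$ let $\mathcal P(\mathcal G,W_q,\delta)$ be the $\delta$-packing number, that is, the largest $M$ for which there are $\mu_1,\dots,\mu_M\in\mathcal G$ with $W_q(\mu_i,\mu_j)>\delta$ for all $i\ne j$. Then for every real $q\ge 1$ and every $\varepsilon>0$ the packing number $\mathcal P(\mathcal G,W_q,2\varepsilon)$ is finite (and at least $1$), and there exists $C>0$ (which may depend on $d$, $\|\cdot\|$, $r$, $q$ and $\varepsilon$) such that $$\ln\Big(\frac1C\Big)+\frac1{\varepsilon^d}\ \le\ \ln\mathcal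 P(\mathcal G,W_q,2\varepsilon)\ \le\ \Big(1+\frac{4r}{\varepsilon}\Big)^d\,\ln\Big(e+\frac{e\,(2r)^q}{\varepsilon^q}\Big).$$ -/

import Mathlib

open scoped ENNReal

noncomputable section

namespace MeanFieldPacking

open MeasureTheory

/-- The empirical measure `M(X) = (1/m) ∑ i, δ_{X i}` of a sequence `X` of `m` vectors
(the columns of the `d × m` matrix of token embeddings). -/
def empiricalMeasure {E : Type*} [MeasurableSpace E] {m : ℕ} (X : Fin m → E) : Measure E :=
  (m : ℝ≥0∞)⁻¹ • ∑ i, Measure.dirac (X i)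

/-- The set of empirical measures of nonempty finite sequences of points of `Θ`. -/
def empiricalMeasures {E : Type*} [MeasurableSpace E] (Θ : Set E) : Set (Measure E) :=
  {μ | ∃ m : ℕ, 1 ≤ m ∧ ∃ X : Fin m → E, (∀ i, X i ∈ Θ) ∧ μ = empiricalMeasure X}

/-- The couplings of `μ` and `ν`: measures on the product with marginals `μ` and `ν`. -/
def couplings {E : Type*} [MeasurableSpace E] (μ ν : Measure E) : Set (Measure (E × E)) :=
  {π | π.map Prod.fst = μ ∧ π.map Prod.snd = ν}

/-- The Wasserstein distance
`W_q(μ, ν) = (inf_π ∫ ‖x - y‖ ^ q dπ(x, y)) ^ (1 / q)`, the infimum being over all couplings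
of `μ` and `ν`; it is valued in `[0, ∞]`. -/
def wasserstein {E : Type*} [NormedAddCommGroup E] [MeasurableSpace E]
    (q : ℝ) (μ ν : Measure E) : ℝ≥0∞ :=
  (⨅ π ∈ couplings μ ν, ∫⁻ p, ‖p.1 - p.2‖ₑ ^ q ∂π) ^ (1 / q)

/-- The `ε`-packing number of `T` for the distance `D`: the largest `M` such that there are points
`x_1, …, x_M` of `T` with `D (x_i) (x_j) > ε` for all `i ≠ j` (`⊤` if there is no largest one). -/
def packingNumber {α : Type*} (T : Set α) (D : α → α → ℝ≥0∞) (ε : ℝ) : ℕ∞ :=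
  ⨆ M ∈ {M : ℕ | ∃ x : Fin M → α, (∀ i, x i ∈ T) ∧
    ∀ i j, i ≠ j → ENNReal.ofReal ε < D (x i) (x j)}, (M : ℕ∞)

end MeanFieldPacking

end

open scoped ENNReal

namespace MeanFieldPacking

open MeasureTheory

/-! ### Couplings adapted to a finite partition -/

section Coupling

variable {E : Type*} [MeasurableSpace E] {ι : Type*} [Fintype ι]

/-! The upper bound is a counting argument. Cut the ball into `n ≤ (1 + 4r/ε)^d` cells of diameter
at most `ε`, and round the cell masses of each measure down to multiples of `1/K`. If two measures
round alike, a coupling that keeps as much mass as possible inside the cells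
(`exists_coupling_lintegral_le`) pays at most `ε^q` for the mass kept and `(2r)^q` per unit of
excess, and the excess is at most `n/(2K)`. For `r > ε`, take `L = (2r/ε)^q` and `K = ⌊nL⌋`: the
cost is at most `2ε^q ≤ (2ε)^q`, so members of a packing round differently
(`card_packing_le_choose`). There are at most `(n+K).choose K ≤ (e(1+L))^n` roundings. For `r ≤ ε`
all distances are at most `2ε` and a packing has one point.

The lower bound only needs a nonempty packing, since `C` may depend on `ε`. -/

theorem map_fst_sum_smul_prod (c : ι → ℝ≥0∞) (μ ν : ι → Measure E)
    [∀ j, IsFiniteMeasure (μ j)] [∀ j, IsFiniteMeasure (ν j)] :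
    (∑ j, c j • (μ j).prod (ν j)).map Prod.fst = ∑ j, (c j * ν j Set.univ) • μ j := by
  ext s hs
  rw [Measure.map_apply measurable_fst hs, Measure.finsetSum_apply, Measure.finsetSum_apply]
  refine Finset.sum_congr rfl fun j _ => ?_
  have h : (Prod.fst ⁻¹' s : Set (E × E)) = s ×ˢ Set.univ := by ext; simp
  rw [h, Measure.smul_apply, Measure.smul_apply, Measure.prod_prod, smul_eq_mul, smul_eq_mul]
  ring

theorem map_snd_sum_smul_prod (c : ι → ℝ≥0∞) (μ ν : ι → Measure E)
    [∀ j, IsFiniteMeasure (μ j)] [∀ j, IsFiniteMeasure (ν j)] :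
    (∑ j, c j • (μ j).prod (ν j)).map Prod.snd = ∑ j, (c j * μ j Set.univ) • ν j := by
  ext s hs
  rw [Measure.map_apply measurable_snd hs, Measure.finsetSum_apply, Measure.finsetSum_apply]
  refine Finset.sum_congr rfl fun j _ => ?_
  have h : (Prod.snd ⁻¹' s : Set (E × E)) = Set.univ ×ˢ s := by ext; simp
  rw [h, Measure.smul_apply, Measure.smul_apply, Measure.prod_prod, smul_eq_mul, smul_eq_mul]
  ring

theorem map_fst_inv_smul_prod (μ ν : Measure E) [IsFiniteMeasure μ] [IsFiniteMeasure ν]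
    (h : μ Set.univ = ν Set.univ) :
    ((μ Set.univ)⁻¹ • μ.prod ν).map Prod.fst = μ := by
  have := map_fst_sum_smul_prod (ι := Unit) (fun _ => (μ Set.univ)⁻¹) (fun _ => μ) (fun _ => ν)
  simp only [Finset.univ_unique, Finset.sum_singleton] at this
  rw [this, ← h]
  rcases eq_or_ne (μ Set.univ) 0 with h0 | h0
  · rw [Measure.measure_univ_eq_zero.1 h0, smul_zero]
  · rw [ENNReal.inv_mul_cancel h0 (measure_ne_top _ _), one_smul]

theorem map_snd_inv_smul_prod (μ ν : Measure E) [IsFiniteMeasure μ] [IsFiniteMeasure ν]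
    (h : μ Set.univ = ν Set.univ) :
    ((μ Set.univ)⁻¹ • μ.prod ν).map Prod.snd = ν := by
  have := map_snd_sum_smul_prod (ι := Unit) (fun _ => (μ Set.univ)⁻¹) (fun _ => μ) (fun _ => ν)
  simp only [Finset.univ_unique, Finset.sum_singleton] at this
  rw [this, h]
  rcases eq_or_ne (ν Set.univ) 0 with h0 | h0
  · rw [Measure.measure_univ_eq_zero.1 h0, smul_zero]
  · rw [ENNReal.inv_mul_cancel h0 (measure_ne_top _ _), one_smul]

/-- `a (b / max a b) = min a b` for finite extended nonnegative reals. -/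
theorem inv_max_mul_mul (a b : ℝ≥0∞) (ha : a ≠ ∞) (hb : b ≠ ∞) :
    (max a b)⁻¹ * (a * b) = min a b := by
  rcases eq_or_ne (max a b) 0 with h | h
  · have h1 : a = 0 := le_antisymm (h ▸ le_max_left a b) bot_le
    simp [h1]
  · rw [← max_mul_min a b, ← mul_assoc, ENNReal.inv_mul_cancel h (by simp [ha, hb]), one_mul]

theorem inv_max_mul_le_one (a b : ℝ≥0∞) : (max a b)⁻¹ * b ≤ 1 := by
  calc (max a b)⁻¹ * b ≤ (max a b)⁻¹ * max a b := by gcongr; exact le_max_right a b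
    _ ≤ 1 := ENNReal.inv_mul_le_one _

theorem one_sub_inv_max_mul (a b : ℝ≥0∞) (ha : a ≠ ∞) (hb : b ≠ ∞) :
    (1 - (max a b)⁻¹ * b) * a = a - b := by
  rw [ENNReal.sub_mul (fun _ _ => ha), one_mul, mul_assoc, mul_comm b a, inv_max_mul_mul a b ha hb]
  rcases le_total a b with h | h
  · simp [h, tsub_eq_zero_of_le h]
  · simp [h]

/-- Adding the finite quantity `∑ min (a j) (b j)` to the two sides gives `∑ a j` and `∑ b j`. This
makes the two leftover masses equal, so that they can be coupled. -/
theorem sum_sub_comm_of_sum_eq (a b : ι → ℝ≥0∞) (ha : ∀ j, a j ≠ ∞)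
    (h : ∑ j, a j = ∑ j, b j) : ∑ j, (a j - b j) = ∑ j, (b j - a j) := by
  have key : ∑ j, (a j - b j) + ∑ j, min (a j) (b j) =
      ∑ j, (b j - a j) + ∑ j, min (a j) (b j) := by
    rw [← Finset.sum_add_distrib, ← Finset.sum_add_distrib]
    convert h using 2 with j _ j _
    · rcases le_total (a j) (b j) with h' | h'
      · rw [min_eq_left h', tsub_eq_zero_of_le h', zero_add]
      · rw [min_eq_right h', tsub_add_cancel_of_le h']
    · rcases le_total (a j) (b j) with h' | h'
      · rw [min_eq_left h', tsub_add_cancel_of_le h']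
      · rw [min_eq_right h', tsub_eq_zero_of_le h', zero_add]
  refine (ENNReal.add_left_inj ?_).1 key
  exact (ENNReal.sum_lt_top.2 fun j _ => lt_of_le_of_lt (min_le_left _ _) (ha j).lt_top).ne

theorem sum_restrict_eq {A : ι → Set E} (hA : ∀ j, MeasurableSet (A j))
    (hd : Pairwise (Function.onFun Disjoint A)) (μ : Measure E) (h0 : μ (⋃ j, A j)ᶜ = 0) :
    ∑ j, μ.restrict (A j) = μ := by
  rw [← Measure.sum_fintype, ← Measure.restrict_iUnion hd hA]
  exact Measure.restrict_eq_self_of_ae_mem (by rw [ae_iff]; exact h0)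

theorem sum_inv_smul_add_residual {A : ι → Set E} (hA : ∀ j, MeasurableSet (A j))
    (hd : Pairwise (Function.onFun Disjoint A)) (μ : Measure E) (h0 : μ (⋃ j, A j)ᶜ = 0)
    (c : ι → ℝ≥0∞) (hc : ∀ j, c j ≤ 1) :
    ∑ j, c j • μ.restrict (A j) + ∑ j, (1 - c j) • μ.restrict (A j) = μ := by
  rw [← Finset.sum_add_distrib]
  conv_rhs => rw [← sum_restrict_eq hA hd μ h0]
  refine Finset.sum_congr rfl fun j _ => ?_
  rw [← add_smul, add_tsub_cancel_of_le (hc j), one_smul]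

theorem lintegral_prod_le_of_forall_mem {μ ν : Measure E} [SFinite μ] [SFinite ν] {A B : Set E}
    (hμ : μ Aᶜ = 0) (hν : ν Bᶜ = 0) {f : E × E → ℝ≥0∞} {c : ℝ≥0∞}
    (hf : ∀ x ∈ A, ∀ y ∈ B, f (x, y) ≤ c) :
    ∫⁻ p, f p ∂(μ.prod ν) ≤ c * (μ Set.univ * ν Set.univ) := by
  have hfst : ∀ᵐ p ∂(μ.prod ν), p.1 ∈ A :=
    Measure.quasiMeasurePreserving_fst.ae (by rw [ae_iff]; exact hμ)
  have hsnd : ∀ᵐ p ∂(μ.prod ν), p.2 ∈ B :=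
    Measure.quasiMeasurePreserving_snd.ae (by rw [ae_iff]; exact hν)
  calc ∫⁻ p, f p ∂(μ.prod ν) ≤ ∫⁻ _, c ∂(μ.prod ν) := by
        refine lintegral_mono_ae ?_
        filter_upwards [hfst, hsnd] with p h1 h2 using hf p.1 h1 p.2 h2
    _ = c * (μ Set.univ * ν Set.univ) := by
        rw [lintegral_const, ← Set.univ_prod_univ, Measure.prod_prod]

/-- Two probability measures carried by a finite disjoint union of cells have a coupling that
moves as much mass as possible inside the cells. -/
theorem exists_coupling_lintegral_le {A : ι → Set E} (hA : ∀ j, MeasurableSet (A j))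
    (hd : Pairwise (Function.onFun Disjoint A)) (μ ν : Measure E)
    [IsProbabilityMeasure μ] [IsProbabilityMeasure ν]
    (hμ : μ (⋃ j, A j)ᶜ = 0) (hν : ν (⋃ j, A j)ᶜ = 0) {f : E × E → ℝ≥0∞} {c C : ℝ≥0∞}
    (hc : ∀ j, ∀ x ∈ A j, ∀ y ∈ A j, f (x, y) ≤ c)
    (hC : ∀ x ∈ ⋃ j, A j, ∀ y ∈ ⋃ j, A j, f (x, y) ≤ C) :
    ∃ π ∈ couplings μ ν, ∫⁻ p, f p ∂π ≤ c + C * ∑ j, (μ (A j) - ν (A j)) := by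
  -- With this weight, the product of the restrictions to cell `j` has mass `min (μ (A j)) (ν (A
  -- j))`, the most the cell can keep.
  set m : ι → ℝ≥0∞ := fun j => (max (μ (A j)) (ν (A j)))⁻¹ with hm
  have hm' : ∀ j, m j = (max (ν (A j)) (μ (A j)))⁻¹ := fun j => by rw [hm, max_comm]
  have hsum : ∀ (ρ : Measure E) [IsProbabilityMeasure ρ], ρ (⋃ j, A j)ᶜ = 0 →
      ∑ j, ρ (A j) = 1 := by
    intro ρ _ h0
    have := congrArg (fun κ : Measure E => κ Set.univ) (sum_restrict_eq hA hd ρ h0)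
    simpa [Measure.finsetSum_apply] using this
  -- `μr` and `νr` are what the in-cell products leave of each marginal; they are coupled by their
  -- normalised product.
  set μr : Measure E := ∑ j, (1 - m j * ν (A j)) • μ.restrict (A j) with hμr
  set νr : Measure E := ∑ j, (1 - m j * μ (A j)) • ν.restrict (A j) with hνr
  have hα : ∀ j, m j * ν (A j) ≤ 1 := fun j => inv_max_mul_le_one _ _
  have hβ : ∀ j, m j * μ (A j) ≤ 1 := fun j => by rw [hm']; exact inv_max_mul_le_one _ _
  have e1 := sum_inv_smul_add_residual hA hd μ hμ _ hα
  have e2 := sum_inv_smul_add_residual hA hd ν hν _ hβ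
  have hμle : μr ≤ μ := by
    conv_rhs => rw [← e1]
    exact Measure.le_add_left le_rfl
  have hνle : νr ≤ ν := by
    conv_rhs => rw [← e2]
    exact Measure.le_add_left le_rfl
  have : IsFiniteMeasure μr := isFiniteMeasure_of_le μ hμle
  have : IsFiniteMeasure νr := isFiniteMeasure_of_le ν hνle
  have hμru : μr Set.univ = ∑ j, (μ (A j) - ν (A j)) := by
    rw [hμr, Measure.finsetSum_apply]
    refine Finset.sum_congr rfl fun j _ => ?_
    rw [Measure.smul_apply, Measure.restrict_apply_univ, smul_eq_mul,
      one_sub_inv_max_mul _ _ (measure_ne_top _ _) (measure_ne_top _ _)]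
  have hνru : νr Set.univ = ∑ j, (ν (A j) - μ (A j)) := by
    rw [hνr, Measure.finsetSum_apply]
    refine Finset.sum_congr rfl fun j _ => ?_
    rw [Measure.smul_apply, Measure.restrict_apply_univ, smul_eq_mul, hm',
      one_sub_inv_max_mul _ _ (measure_ne_top _ _) (measure_ne_top _ _)]
  have huniv : μr Set.univ = νr Set.univ := by
    rw [hμru, hνru]
    exact sum_sub_comm_of_sum_eq _ _ (fun _ => measure_ne_top _ _)
      ((hsum μ hμ).trans (hsum ν hν).symm)
  refine ⟨∑ j, m j • (μ.restrict (A j)).prod (ν.restrict (A j)) +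
    (μr Set.univ)⁻¹ • μr.prod νr, ⟨?_, ?_⟩, ?_⟩
  · rw [Measure.map_add _ _ measurable_fst, map_fst_sum_smul_prod,
      map_fst_inv_smul_prod _ _ huniv]
    simpa only [Measure.restrict_apply_univ] using e1
  · rw [Measure.map_add _ _ measurable_snd, map_snd_sum_smul_prod,
      map_snd_inv_smul_prod _ _ huniv]
    simpa only [Measure.restrict_apply_univ] using e2
  · rw [lintegral_add_measure, lintegral_finsetSum_measure, lintegral_smul_measure, ← hμru]
    refine add_le_add ?_ ?_
    · calc ∑ j, ∫⁻ p, f p ∂(m j • (μ.restrict (A j)).prod (ν.restrict (A j)))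
          ≤ ∑ j, c * μ (A j) := by
            refine Finset.sum_le_sum fun j _ => ?_
            have h := lintegral_prod_le_of_forall_mem (μ := μ.restrict (A j))
              (ν := ν.restrict (A j)) (A := A j) (B := A j)
              (by simp [Measure.restrict_apply (hA j).compl])
              (by simp [Measure.restrict_apply (hA j).compl]) (hc j)
            rw [Measure.restrict_apply_univ, Measure.restrict_apply_univ] at h
            rw [lintegral_smul_measure, smul_eq_mul]
            calc _ ≤ m j * (c * (μ (A j) * ν (A j))) := by gcongr
              _ = c * (m j * (μ (A j) * ν (A j))) := by ring
              _ = c * min (μ (A j)) (ν (A j)) := by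
                rw [inv_max_mul_mul _ _ (measure_ne_top _ _) (measure_ne_top _ _)]
              _ ≤ c * μ (A j) := by gcongr; exact min_le_left _ _
        _ = c := by rw [← Finset.mul_sum, hsum μ hμ, mul_one]
    · have h := lintegral_prod_le_of_forall_mem (μ := μr) (ν := νr)
        (le_antisymm ((hμle _).trans hμ.le) bot_le) (le_antisymm ((hνle _).trans hν.le) bot_le) hC
      rw [← huniv] at h
      rw [smul_eq_mul]
      calc _ ≤ (μr Set.univ)⁻¹ * (C * (μr Set.univ * μr Set.univ)) := by gcongr
        _ = C * μr Set.univ * ((μr Set.univ)⁻¹ * μr Set.univ) := by ring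
        _ ≤ C * μr Set.univ * 1 := by gcongr; exact ENNReal.inv_mul_le_one _
        _ = C * μr Set.univ := mul_one _

end Coupling

theorem wasserstein_le_of_cells {E : Type*} [NormedAddCommGroup E] [MeasurableSpace E]
    {ι : Type*} [Fintype ι] {A : ι → Set E} (hA : ∀ j, MeasurableSet (A j))
    (hd : Pairwise (Function.onFun Disjoint A)) (μ ν : Measure E)
    [IsProbabilityMeasure μ] [IsProbabilityMeasure ν]
    (hμ : μ (⋃ j, A j)ᶜ = 0) (hν : ν (⋃ j, A j)ᶜ = 0) {q : ℝ} (hq : 0 < q) {a D t : ℝ}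
    (ha : 0 ≤ a) (hD : 0 ≤ D)
    (hc : ∀ j, ∀ x ∈ A j, ∀ y ∈ A j, ‖x - y‖ ≤ a)
    (hC : ∀ x ∈ ⋃ j, A j, ∀ y ∈ ⋃ j, A j, ‖x - y‖ ≤ D)
    (ht : ∑ j, (μ (A j) - ν (A j)) ≤ ENNReal.ofReal t) (ht0 : 0 ≤ t) {δ : ℝ} (hδ : 0 ≤ δ)
    (hle : a ^ q + D ^ q * t ≤ δ ^ q) :
    wasserstein q μ ν ≤ ENNReal.ofReal δ := by
  have hpow : ∀ x y : E, ∀ b : ℝ, 0 ≤ b → ‖x - y‖ ≤ b → ‖x - y‖ₑ ^ q ≤ ENNReal.ofReal (b ^ q) := by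
    intro x y b hb h
    rw [← ENNReal.ofReal_rpow_of_nonneg hb hq.le, ← ofReal_norm]
    exact ENNReal.rpow_le_rpow (ENNReal.ofReal_le_ofReal h) hq.le
  obtain ⟨π, hπ, h⟩ := exists_coupling_lintegral_le hA hd μ ν hμ hν
    (f := fun p => ‖p.1 - p.2‖ₑ ^ q) (c := ENNReal.ofReal (a ^ q)) (C := ENNReal.ofReal (D ^ q))
    (fun j x hx y hy => hpow x y a ha (hc j x hx y hy))
    (fun x hx y hy => hpow x y D hD (hC x hx y hy))
  rw [wasserstein, one_div, ENNReal.rpow_inv_le_iff hq, ENNReal.ofReal_rpow_of_nonneg hδ hq.le]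
  refine (iInf₂_le π hπ).trans (h.trans ?_)
  calc _ ≤ ENNReal.ofReal (a ^ q) + ENNReal.ofReal (D ^ q) * ENNReal.ofReal t := by gcongr
    _ = ENNReal.ofReal (a ^ q + D ^ q * t) := by
      rw [← ENNReal.ofReal_mul (by positivity), ← ENNReal.ofReal_add (by positivity)
        (by positivity)]
    _ ≤ ENNReal.ofReal (δ ^ q) := ENNReal.ofReal_le_ofReal hle

/-! ### Separated sets, nets and cells of the ball -/

section Nets

variable {E : Type*} [NormedAddCommGroup E] [NormedSpace ℝ E] [FiniteDimensional ℝ E]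

/-- Volume comparison: the balls of radius `ρ/2` about the points are disjoint and lie in the ball
of radius `r + ρ/2`. -/
theorem card_le_of_separated_ball {r ρ : ℝ} (hr : 0 < r) (hρ : 0 < ρ) (s : Finset E)
    (hs : ∀ c ∈ s, ‖c‖ < r) (h : ∀ c ∈ s, ∀ c' ∈ s, c ≠ c' → ρ ≤ ‖c - c'‖) :
    (s.card : ℝ) ≤ (1 + 2 * r / ρ) ^ Module.finrank ℝ E := by
  borelize E
  let μ : Measure E := Measure.addHaar
  have hδ : 0 < ρ / 2 := by positivity
  have hR : 0 < r + ρ / 2 := by positivity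
  have D : Set.Pairwise (s : Set E) (Function.onFun Disjoint fun c => Metric.ball c (ρ / 2)) := by
    intro c hc c' hc' hne
    refine Metric.ball_disjoint_ball ?_
    rw [dist_eq_norm, add_halves]
    exact h c hc c' hc' hne
  have hsub : (⋃ c ∈ s, Metric.ball c (ρ / 2)) ⊆ Metric.ball (0 : E) (r + ρ / 2) := by
    refine Set.iUnion₂_subset fun x hx => Metric.ball_subset_ball' ?_
    rw [dist_zero_right]
    linarith [hs x hx]
  have I : (s.card : ℝ≥0∞) * ENNReal.ofReal ((ρ / 2) ^ Module.finrank ℝ E) * μ (Metric.ball 0 1) ≤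
      ENNReal.ofReal ((r + ρ / 2) ^ Module.finrank ℝ E) * μ (Metric.ball 0 1) := by
    calc _ = μ (⋃ c ∈ s, Metric.ball c (ρ / 2)) := by
          rw [measure_biUnion_finset D fun c _ => measurableSet_ball]
          simp only [μ.addHaar_ball_of_pos _ hδ, Finset.sum_const, nsmul_eq_mul, mul_assoc]
      _ ≤ μ (Metric.ball (0 : E) (r + ρ / 2)) := measure_mono hsub
      _ = _ := by rw [μ.addHaar_ball_of_pos _ hR]
  have J := (ENNReal.mul_le_mul_iff_left (Metric.measure_ball_pos μ (0 : E) zero_lt_one).ne'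
    measure_ball_lt_top.ne).1 I
  have K := ENNReal.toReal_le_of_le_ofReal (pow_nonneg hR.le _) J
  rw [ENNReal.toReal_mul, ENNReal.toReal_natCast, ENNReal.toReal_ofReal (by positivity),
    ← le_div_iff₀ (by positivity), ← div_pow] at K
  have e : 1 + 2 * r / ρ = (r + ρ / 2) / (ρ / 2) := by
    field_simp
    ring
  rwa [e]

/-- A separated set of maximal cardinality is a net: a point far from all its members could be
added. -/
theorem exists_finset_net_ball {r ρ : ℝ} (hr : 0 < r) (hρ : 0 < ρ) :
    ∃ s : Finset E, s.Nonempty ∧ (s.card : ℝ) ≤ (1 + 2 * r / ρ) ^ Module.finrank ℝ E ∧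
      ∀ x : E, ‖x‖ < r → ∃ c ∈ s, ‖x - c‖ < ρ := by
  classical
  let P : Finset E → Prop := fun s =>
    (∀ c ∈ s, ‖c‖ < r) ∧ ∀ c ∈ s, ∀ c' ∈ s, c ≠ c' → ρ ≤ ‖c - c'‖
  let S : Set ℕ := {n | ∃ s, P s ∧ s.card = n}
  have hne : S.Nonempty := ⟨0, ∅, by simp [P], by simp⟩
  have hb : BddAbove S := by
    refine ⟨⌊(1 + 2 * r / ρ) ^ Module.finrank ℝ E⌋₊, ?_⟩
    rintro n ⟨s, hs, rfl⟩
    exact Nat.le_floor (card_le_of_separated_ball hr hρ s hs.1 hs.2)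
  obtain ⟨s, hs, hcard⟩ := Nat.sSup_mem hne hb
  have hnet : ∀ x : E, ‖x‖ < r → ∃ c ∈ s, ‖x - c‖ < ρ := by
    intro x hx
    by_contra! hfar
    have hxs : x ∉ s := fun hmem => by
      have := hfar x hmem
      rw [sub_self, norm_zero] at this
      linarith
    have hP : P (insert x s) := by
      refine ⟨?_, ?_⟩
      · intro c hc
        rcases Finset.mem_insert.1 hc with rfl | hc
        · exact hx
        · exact hs.1 c hc
      · intro c hc c' hc' hcc
        rcases Finset.mem_insert.1 hc with h1 | h1 <;>
          rcases Finset.mem_insert.1 hc' with h2 | h2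
        · exact absurd (h1.trans h2.symm) hcc
        · rw [h1]; exact hfar c' h2
        · rw [h2, norm_sub_rev]; exact hfar c h1
        · exact hs.2 c h1 c' h2 hcc
    have := le_csSup hb (show (insert x s).card ∈ S from ⟨_, hP, rfl⟩)
    rw [Finset.card_insert_of_notMem hxs, hcard] at this
    omega
  refine ⟨s, ?_, card_le_of_separated_ball hr hρ s hs.1 hs.2, hnet⟩
  obtain ⟨c, hc, -⟩ := hnet 0 (by simpa using hr)
  exact ⟨c, hc⟩

/-- The ball of radius `r` splits into few measurable cells of diameter at most `2 ρ`. -/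
theorem exists_cells_ball [MeasurableSpace E] [BorelSpace E] {r ρ : ℝ} (hr : 0 < r) (hρ : 0 < ρ) :
    ∃ n : ℕ, 0 < n ∧ (n : ℝ) ≤ (1 + 2 * r / ρ) ^ Module.finrank ℝ E ∧
      ∃ A : Fin n → Set E, (∀ j, MeasurableSet (A j)) ∧ Pairwise (Function.onFun Disjoint A) ∧
        (⋃ j, A j) = Metric.ball 0 r ∧ ∀ j, ∀ x ∈ A j, ∀ y ∈ A j, ‖x - y‖ ≤ 2 * ρ := by
  obtain ⟨s, hsne, hcard, hnet⟩ := exists_finset_net_ball (E := E) hr hρ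
  let c : Fin s.card → E := fun j => s.equivFin.symm j
  -- Intersecting with the ball makes the union of the cells exactly the ball.
  let B : Fin s.card → Set E := fun j => Metric.ball (c j) ρ ∩ Metric.ball 0 r
  have hsub : ∀ j, disjointed B j ⊆ B j := fun j => disjointed_subset B j
  refine ⟨s.card, hsne.card_pos, hcard, disjointed B, ?_, disjoint_disjointed B, ?_, ?_⟩
  · intro j
    exact disjointedRec (fun t i ht => ht.diff (measurableSet_ball.inter measurableSet_ball))
      (measurableSet_ball.inter measurableSet_ball)
  · rw [iUnion_disjointed]
    refine Set.Subset.antisymm (Set.iUnion_subset fun j => Set.inter_subset_right) fun x hx => ?_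
    obtain ⟨y, hy, hxy⟩ := hnet x (by simpa using hx)
    refine Set.mem_iUnion.2 ⟨s.equivFin ⟨y, hy⟩, ?_, hx⟩
    simpa [c, Metric.mem_ball, dist_eq_norm] using hxy
  · intro j x hx y hy
    have h1 := Metric.mem_ball.1 (hsub j hx).1
    have h2 := Metric.mem_ball.1 (hsub j hy).1
    rw [← dist_eq_norm]
    linarith [dist_triangle_right x y (c j)]

end Nets

/-! ### Counting rounded mass vectors -/

section Counting

/-- Combine `(n+K).choose n ≤ (n+K)^n / n!` with `n^n / n! ≤ e^n`. -/
theorem choose_le_exp_mul_pow (n K : ℕ) (hn : 0 < n) :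
    ((n + K).choose K : ℝ) ≤ (Real.exp 1 * (1 + K / n)) ^ n := by
  have hn' : (0 : ℝ) < n := by exact_mod_cast hn
  have hf : (0 : ℝ) < n.factorial := by exact_mod_cast n.factorial_pos
  have h1 : ((n + K).choose K : ℝ) ≤ ((n + K : ℕ) : ℝ) ^ n / n.factorial := by
    rw [← Nat.choose_symm_add]
    exact Nat.choose_le_pow_div n (n + K)
  have h2 : (n : ℝ) ^ n / n.factorial ≤ Real.exp 1 ^ n := by
    have := Real.pow_div_factorial_le_exp (n : ℝ) hn'.le n
    rwa [← Real.exp_one_pow] at this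
  calc _ ≤ ((n + K : ℕ) : ℝ) ^ n / n.factorial := h1
    _ = (n : ℝ) ^ n / n.factorial * (1 + K / n) ^ n := by
      rw [div_mul_eq_mul_div, ← mul_pow]
      congr 2
      push_cast
      field_simp
    _ ≤ Real.exp 1 ^ n * (1 + K / n) ^ n := by gcongr
    _ = _ := by rw [mul_pow]

theorem card_le_choose_of_injective {M n K : ℕ} (a : Fin M → Fin n → ℕ)
    (ha : Function.Injective a) (hK : ∀ i, ∑ j, a i j ≤ K) : M ≤ (n + K).choose K := by
  classical
  -- The slack coordinate `none` turns a sum at most `K` into a sum equal to `K`.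
  let g : Fin M → (Option (Fin n) →₀ ℕ) := fun i =>
    Finsupp.equivFunOnFinite.symm fun o => o.elim (K - ∑ j, a i j) (a i)
  have hg : Function.Injective g := by
    intro i i' h
    refine ha (funext fun j => ?_)
    simpa [g] using DFunLike.congr_fun h (some j)
  have hmem : ∀ i, g i ∈ (Finset.univ : Finset (Option (Fin n))).finsuppAntidiag K := by
    intro i
    rw [Finset.mem_finsuppAntidiag]
    refine ⟨?_, Finset.subset_univ _⟩
    rw [Fintype.sum_option]
    simpa [g] using Nat.sub_add_cancel (hK i)
  have := Finset.card_le_card_of_injOn (s := (Finset.univ : Finset (Fin M))) g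
    (fun i _ => hmem i) hg.injOn
  rw [Finset.card_finsuppAntidiag_nat_eq_choose] at this
  simpa [add_right_comm] using this

/-- Equal floors put the masses within `1/K` of each other. Since the differences sum to zero, the
positive parts make up half of the total variation, whence the factor 2 in `2 * K`. -/
theorem sum_posPart_sub_le_of_floor_eq {n K : ℕ} (hK : 0 < K) (p p' : Fin n → ℝ)
    (hp : ∀ j, 0 ≤ p j) (hp' : ∀ j, 0 ≤ p' j) (hsum : ∑ j, p j = ∑ j, p' j)
    (h : ∀ j, ⌊K * p j⌋₊ = ⌊K * p' j⌋₊) :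
    ∑ j, max (p j - p' j) 0 ≤ n / (2 * K) := by
  have hK' : (0 : ℝ) < K := by exact_mod_cast hK
  have key : ∀ j, max (p j - p' j) 0 ≤ 1 / (2 * K) + (p j - p' j) / 2 := by
    intro j
    have a1 := Nat.floor_le (mul_nonneg hK'.le (hp j))
    have a2 := Nat.lt_floor_add_one (K * p j)
    have b1 := Nat.floor_le (mul_nonneg hK'.le (hp' j))
    have b2 := Nat.lt_floor_add_one (K * p' j)
    rw [h j] at a1 a2
    have e1 : p j - p' j ≤ 1 / K := by rw [le_div_iff₀ hK']; linarith
    have e2 : p' j - p j ≤ 1 / K := by rw [le_div_iff₀ hK']; linarith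
    have e3 : (1 : ℝ) / (2 * K) = 1 / K / 2 := by field_simp
    rw [e3]
    refine max_le ?_ ?_ <;> linarith
  calc _ ≤ ∑ j, (1 / (2 * K) + (p j - p' j) / 2) := Finset.sum_le_sum fun j _ => key j
    _ = n / (2 * K) := by
      rw [Finset.sum_add_distrib, ← Finset.sum_div _ (fun j => p j - p' j),
        Finset.sum_sub_distrib, hsum]
      simp [div_eq_mul_inv]

theorem sum_measure_sub_le {E : Type*} [MeasurableSpace E] (μ ν : Measure E)
    [IsFiniteMeasure μ] [IsFiniteMeasure ν] {n : ℕ} (A : Fin n → Set E) {t : ℝ}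
    (h : ∑ j, max (μ.real (A j) - ν.real (A j)) 0 ≤ t) :
    ∑ j, (μ (A j) - ν (A j)) ≤ ENNReal.ofReal t := by
  refine le_trans ?_ (ENNReal.ofReal_le_ofReal h)
  rw [ENNReal.ofReal_sum_of_nonneg fun j _ => le_max_right _ _]
  refine Finset.sum_le_sum fun j _ => ?_
  rw [← ofReal_measureReal (μ := μ) (s := A j), ← ofReal_measureReal (μ := ν) (s := A j),
    ← ENNReal.ofReal_sub _ measureReal_nonneg]
  exact ENNReal.ofReal_le_ofReal (le_max_left _ _)

end Counting

/-! ### Elementary facts on empirical measures -/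

section EmpiricalMeasures

variable {E : Type*} [MeasurableSpace E]

theorem isProbabilityMeasure_of_mem_empiricalMeasures {Θ : Set E} {μ : Measure E}
    (h : μ ∈ empiricalMeasures Θ) : IsProbabilityMeasure μ := by
  obtain ⟨m, hm, X, -, rfl⟩ := h
  refine ⟨?_⟩
  rw [empiricalMeasure, Measure.smul_apply, Measure.finsetSum_apply]
  simp only [measure_univ, Finset.sum_const, Finset.card_univ, Fintype.card_fin, nsmul_eq_mul,
    mul_one, smul_eq_mul]
  exact ENNReal.inv_mul_cancel (by simp; omega) (ENNReal.natCast_ne_top m)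

theorem measure_compl_eq_zero_of_mem_empiricalMeasures {Θ : Set E} (hΘ : MeasurableSet Θ)
    {μ : Measure E} (h : μ ∈ empiricalMeasures Θ) : μ Θᶜ = 0 := by
  obtain ⟨m, hm, X, hX, rfl⟩ := h
  rw [empiricalMeasure, Measure.smul_apply, Measure.finsetSum_apply]
  simp [Measure.dirac_apply' _ hΘ.compl, hX]

theorem empiricalMeasures_nonempty {Θ : Set E} (hΘ : Θ.Nonempty) :
    (empiricalMeasures Θ).Nonempty := by
  obtain ⟨x, hx⟩ := hΘ
  exact ⟨_, 1, le_rfl, fun _ => x, fun _ => hx, rfl⟩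

theorem sum_real_cells_eq_one {n : ℕ} {A : Fin n → Set E} (hA : ∀ j, MeasurableSet (A j))
    (hd : Pairwise (Function.onFun Disjoint A)) (μ : Measure E) [IsProbabilityMeasure μ]
    (h0 : μ (⋃ j, A j)ᶜ = 0) : ∑ j, μ.real (A j) = 1 := by
  have h := (prob_compl_eq_zero_iff (MeasurableSet.iUnion hA)).1 h0
  rw [measure_iUnion hd hA, tsum_fintype] at h
  simp only [measureReal_def]
  rw [← ENNReal.toReal_sum fun j _ => measure_ne_top _ _, h, ENNReal.toReal_one]

end EmpiricalMeasures

theorem exists_packingNumber_eq_natCast {α : Type*} {T : Set α} (hT : T.Nonempty)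
    (D : α → α → ℝ≥0∞) (ε : ℝ) {b : ℝ}
    (h : ∀ (M : ℕ) (x : Fin M → α), (∀ i, x i ∈ T) →
      (∀ i j, i ≠ j → ENNReal.ofReal ε < D (x i) (x j)) → (M : ℝ) ≤ b) :
    ∃ P : ℕ, packingNumber T D ε = P ∧ 1 ≤ P ∧ (P : ℝ) ≤ b := by
  obtain ⟨t, ht⟩ := hT
  have h1 : (1 : ℝ) ≤ b := by
    have := h 1 (fun _ => t) (fun _ => ht) fun i j hij => absurd (Subsingleton.elim i j) hij
    simpa using this
  have hle : packingNumber T D ε ≤ (⌊b⌋₊ : ℕ∞) := by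
    refine iSup₂_le fun M hM => ?_
    obtain ⟨x, hx, hD⟩ := hM
    exact_mod_cast Nat.le_floor (h M x hx hD)
  have hge : (1 : ℕ∞) ≤ packingNumber T D ε := by
    have h1 : (1 : ℕ) ∈ {M : ℕ | ∃ x : Fin M → α, (∀ i, x i ∈ T) ∧
        ∀ i j, i ≠ j → ENNReal.ofReal ε < D (x i) (x j)} :=
      ⟨fun _ => t, fun _ => ht, fun i j hij => absurd (Subsingleton.elim i j) hij⟩
    exact_mod_cast le_iSup₂ (f := fun (M : ℕ) (_ : M ∈ {M : ℕ | ∃ x : Fin M → α, (∀ i, x i ∈ T) ∧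
        ∀ i j, i ≠ j → ENNReal.ofReal ε < D (x i) (x j)}) => (M : ℕ∞)) 1 h1
  obtain ⟨P, hP⟩ := ENat.ne_top_iff_exists.1 (ne_top_of_le_ne_top (ENat.natCast_ne_top _) hle)
  rw [← hP] at hle hge
  refine ⟨P, hP.symm, by exact_mod_cast hge, ?_⟩
  exact (Nat.le_floor_iff (by linarith)).1 (by exact_mod_cast hle)

/-! ### Bounds on packings -/

section Packing

variable {E : Type*} [NormedAddCommGroup E] [MeasurableSpace E] [BorelSpace E]

theorem wasserstein_le_of_mem_empiricalMeasures_ball {r q δ : ℝ} (hq : 0 < q) (hr : 0 < r)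
    (hδ : 2 * r ≤ δ) {μ ν : Measure E} (hμ : μ ∈ empiricalMeasures (Metric.ball (0 : E) r))
    (hν : ν ∈ empiricalMeasures (Metric.ball (0 : E) r)) :
    wasserstein q μ ν ≤ ENNReal.ofReal δ := by
  have := isProbabilityMeasure_of_mem_empiricalMeasures hμ
  have := isProbabilityMeasure_of_mem_empiricalMeasures hν
  have hμ0 := measure_compl_eq_zero_of_mem_empiricalMeasures measurableSet_ball hμ
  have hν0 := measure_compl_eq_zero_of_mem_empiricalMeasures measurableSet_ball hν
  have hdiam : ∀ x ∈ Metric.ball (0 : E) r, ∀ y ∈ Metric.ball (0 : E) r, ‖x - y‖ ≤ 2 * r := by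
    intro x hx y hy
    rw [mem_ball_zero_iff] at hx hy
    linarith [norm_sub_le x y]
  -- The whole ball serves as a single cell, so there is no excess mass.
  refine wasserstein_le_of_cells (A := fun _ : Unit => Metric.ball (0 : E) r)
    (fun _ => measurableSet_ball) (Subsingleton.pairwise) μ ν (by rwa [Set.iUnion_const])
    (by rwa [Set.iUnion_const]) hq (a := 2 * r) (D := 2 * r) (t := 0) (by positivity) (by positivity)
    (fun _ => hdiam) (by simpa using hdiam) ?_ le_rfl (by linarith) ?_
  · simp [(prob_compl_eq_zero_iff measurableSet_ball).1 hμ0,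
      (prob_compl_eq_zero_iff measurableSet_ball).1 hν0]
  · rw [mul_zero, add_zero]
    exact Real.rpow_le_rpow (by positivity) hδ hq.le

/-- Rounding the masses of the cells of a partition separates a packing. -/
theorem card_packing_le_choose {r q ε : ℝ} (hq : 1 ≤ q) (hr : 0 < r) (hε : 0 < ε) {n K : ℕ}
    (hK : 0 < K) (hnK : n * (2 * r / ε) ^ q ≤ 2 * K)
    {A : Fin n → Set E} (hA : ∀ j, MeasurableSet (A j))
    (hd : Pairwise (Function.onFun Disjoint A)) (hU : (⋃ j, A j) = Metric.ball 0 r)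
    (hdiam : ∀ j, ∀ x ∈ A j, ∀ y ∈ A j, ‖x - y‖ ≤ ε)
    {M : ℕ} (x : Fin M → Measure E) (hx : ∀ i, x i ∈ empiricalMeasures (Metric.ball (0 : E) r))
    (hsep : ∀ i j, i ≠ j → ENNReal.ofReal (2 * ε) < wasserstein q (x i) (x j)) :
    M ≤ (n + K).choose K := by
  have hK' : (0 : ℝ) < K := by exact_mod_cast hK
  have hprob := fun i => isProbabilityMeasure_of_mem_empiricalMeasures (hx i)
  have h0 : ∀ i, x i (⋃ j, A j)ᶜ = 0 := fun i => by
    rw [hU]; exact measure_compl_eq_zero_of_mem_empiricalMeasures measurableSet_ball (hx i)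
  have hsum := fun i => sum_real_cells_eq_one hA hd (x i) (h0 i)
  refine card_le_choose_of_injective (fun i j => ⌊K * (x i).real (A j)⌋₊) ?_ ?_
  · intro i i' hii
    by_contra hne
    refine absurd (hsep i i' hne) (not_lt.2 ?_)
    have ht := sum_posPart_sub_le_of_floor_eq hK (fun j => (x i).real (A j))
      (fun j => (x i').real (A j)) (fun _ => measureReal_nonneg) (fun _ => measureReal_nonneg)
      ((hsum i).trans (hsum i').symm) (fun j => congrFun hii j)
    refine wasserstein_le_of_cells hA hd (x i) (x i') (h0 i) (h0 i') (by linarith)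
      (a := ε) (D := 2 * r) hε.le (by positivity) hdiam ?_ (sum_measure_sub_le _ _ A ht)
      (by positivity) (by positivity) ?_
    · rw [hU]
      intro x hx y hy
      rw [mem_ball_zero_iff] at hx hy
      linarith [norm_sub_le x y]
    · rw [Real.div_rpow (by positivity) hε.le] at hnK
      have hεq : 0 < ε ^ q := Real.rpow_pos_of_pos hε q
      have h1 : (2 * r) ^ q * (n / (2 * K)) ≤ ε ^ q := by
        rw [mul_div_assoc', div_le_iff₀ hεq] at hnK
        rw [mul_div_assoc', div_le_iff₀ (by positivity)]
        linarith
      -- Here `q ≥ 1` matters: it absorbs the two costs `ε^q` into `(2ε)^q`.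
      have h2 : (2 : ℝ) ≤ 2 ^ q := by
        simpa using Real.rpow_le_rpow_of_exponent_le (x := 2) one_le_two hq
      rw [Real.mul_rpow zero_le_two hε.le]
      nlinarith
  · intro i
    have : ((∑ j, ⌊K * (x i).real (A j)⌋₊ : ℕ) : ℝ) ≤ K := by
      push_cast
      calc _ ≤ ∑ j, K * (x i).real (A j) :=
            Finset.sum_le_sum fun j _ => Nat.floor_le (by positivity)
        _ = K := by rw [← Finset.mul_sum, hsum i, mul_one]
    exact_mod_cast this

theorem card_packing_le [NormedSpace ℝ E] [FiniteDimensional ℝ E] {r q ε : ℝ} (hq : 1 ≤ q)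
    (hr : 0 < r) (hε : 0 < ε) {M : ℕ} (x : Fin M → Measure E)
    (hx : ∀ i, x i ∈ empiricalMeasures (Metric.ball (0 : E) r))
    (hsep : ∀ i j, i ≠ j → ENNReal.ofReal (2 * ε) < wasserstein q (x i) (x j)) :
    (M : ℝ) ≤ (Real.exp 1 + Real.exp 1 * (2 * r) ^ q / ε ^ q) ^
      ((1 + 4 * r / ε) ^ Module.finrank ℝ E : ℝ) := by
  have hL0 : 0 ≤ (2 * r / ε) ^ q := by positivity
  have hexp : 1 ≤ Real.exp 1 := Real.one_le_exp zero_le_one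
  have hbase : Real.exp 1 + Real.exp 1 * (2 * r) ^ q / ε ^ q =
      Real.exp 1 * (1 + (2 * r / ε) ^ q) := by
    rw [Real.div_rpow (by positivity) hε.le]
    ring
  have hbase1 : 1 ≤ Real.exp 1 * (1 + (2 * r / ε) ^ q) := by nlinarith
  rw [hbase]
  rcases le_or_gt r ε with hrε | hrε
  · have hM : M ≤ 1 := by
      by_contra! hM
      refine absurd (hsep ⟨0, by omega⟩ ⟨1, hM⟩ (by simp)) (not_lt.2 ?_)
      exact wasserstein_le_of_mem_empiricalMeasures_ball (by linarith) hr (by linarith) (hx _) (hx _)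
    calc (M : ℝ) ≤ 1 := by exact_mod_cast hM
      _ ≤ _ := Real.one_le_rpow hbase1 (by positivity)
  -- Radius `ε/2` gives cells of diameter at most `ε` and turns `1 + 2r/ρ` into `1 + 4r/ε`.
  · obtain ⟨n, hn, hcard, A, hA, hd, hU, hdiam⟩ := exists_cells_ball (E := E) hr (half_pos hε)
    have hn1 : (1 : ℝ) ≤ n := by exact_mod_cast hn
    have hL2 : 2 ≤ (2 * r / ε) ^ q := by
      have h2 : 2 ≤ 2 * r / ε := by rw [le_div_iff₀ hε]; linarith
      calc (2 : ℝ) ≤ 2 * r / ε := h2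
        _ = (2 * r / ε) ^ (1 : ℝ) := (Real.rpow_one _).symm
        _ ≤ _ := Real.rpow_le_rpow_of_exponent_le (by linarith) hq
    set L := (2 * r / ε) ^ q
    have hnL : 2 ≤ n * L := by nlinarith
    have hfl := Nat.floor_le (show 0 ≤ n * L by positivity)
    have hfl' := Nat.lt_floor_add_one (n * L)
    -- Rounding `nL` down keeps `K/n ≤ L`, and `nL ≥ 2` still ensures `nL ≤ 2K`.
    have hM := card_packing_le_choose hq hr hε (K := ⌊n * L⌋₊)
      (Nat.floor_pos.2 (by linarith)) (by linarith) hA hd hU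
      (by simpa only [mul_div_cancel₀ ε (two_ne_zero' ℝ)] using hdiam) x hx hsep
    have hKn : (⌊n * L⌋₊ : ℝ) / n ≤ L := by
      rw [div_le_iff₀ (by linarith)]
      linarith
    calc (M : ℝ) ≤ ((n + ⌊n * L⌋₊).choose ⌊n * L⌋₊ : ℝ) := by exact_mod_cast hM
      _ ≤ (Real.exp 1 * (1 + ⌊n * L⌋₊ / n)) ^ n := choose_le_exp_mul_pow _ _ hn
      _ ≤ (Real.exp 1 * (1 + L)) ^ n := by gcongr
      _ = (Real.exp 1 * (1 + L)) ^ (n : ℝ) := (Real.rpow_natCast _ _).symm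
      _ ≤ _ := by
        refine Real.rpow_le_rpow_of_exponent_le hbase1 (hcard.trans_eq ?_)
        congr 2
        field_simp
        ring

end Packing

end MeanFieldPacking

theorem mainTheorem6 {E : Type*} [NormedAddCommGroup E] [NormedSpace ℝ E] [FiniteDimensional ℝ E]
    [MeasurableSpace E] [BorelSpace E] (d : ℕ) (hd : 1 ≤ d) (hE : Module.finrank ℝ E = d)
    (r : ℝ) (hr : 0 < r) (q : ℝ) (hq : 1 ≤ q) (ε : ℝ) (hε : 0 < ε) :
    ∃ P : ℕ,
      MeanFieldPacking.packingNumber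
          (MeanFieldPacking.empiricalMeasures (Metric.ball (0 : E) r))
          (MeanFieldPacking.wasserstein q) (2 * ε) = (P : ℕ∞) ∧
      1 ≤ P ∧
      ∃ C : ℝ, 0 < C ∧
        Real.log (1 / C) + 1 / ε ^ d ≤ Real.log (P : ℝ) ∧
        Real.log (P : ℝ) ≤
          (1 + 4 * r / ε) ^ d *
            Real.log (Real.exp 1 + Real.exp 1 * (2 * r) ^ q / ε ^ q) := by
  obtain ⟨P, hP, hP1, hPb⟩ := MeanFieldPacking.exists_packingNumber_eq_natCast
    (MeanFieldPacking.empiricalMeasures_nonempty (Metric.nonempty_ball.2 hr :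
      (Metric.ball (0 : E) r).Nonempty))
    (MeanFieldPacking.wasserstein q) (2 * ε)
    fun M x hx hsep => MeanFieldPacking.card_packing_le hq hr hε x hx hsep
  have hP1' : (1 : ℝ) ≤ P := by exact_mod_cast hP1
  -- This `C` makes the left side of the lower bound zero.
  refine ⟨P, hP, hP1, Real.exp (1 / ε ^ d), Real.exp_pos _, ?_, ?_⟩
  · rw [one_div (Real.exp _), Real.log_inv, Real.log_exp, neg_add_cancel]
    exact Real.log_nonneg hP1'
  · rw [hE] at hPb
    rw [← Real.log_rpow (by positivity)]
    exact Real.log_le_log (by linarith) hPb
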